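/- Let $\lambda = 2\cos(\pi/5)$ and let $H_5$ be the subgroup of $SL(2,\mathbb{Z}[\lambda])$ generated by $S=\begin{pmatrix}0&1\\-1&0\end{pmatrix}$ and $T=\begin{pmatrix}1&\lambda\\0&1\end{pmatrix}$. For $a\in\mathbb{Z}[\lambda]$ let $H(a)=\{A\in H_5 : A\equiv I \pmod a\}$, where the congruence is entrywise modulo the ideal $(a)$. Let $Z=\langle\pm I\rangle$, let $G_5=H_5/Z$, and let $G(a)=H(a)Z/Z\subseteq G_5$. Then $G(2)/G(4)$ is an elementary abelian group of order $2^4$. Moreover, for every $\alpha\in\mathbb{Z}[\lambda]$ such that $\gcd(2,\alpha)=1$ and $(\alpha)\neq(1)$, the group $G(2\alpha)/G(4\alpha)$ is elementary abelian of order $2^5$. -/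

import Mathlib

noncomputable section

open scoped MatrixGroups

namespace HeckeFive

/-- The real number `λ = 2 cos (π / 5)`. -/
def lam : ℝ := 2 * Real.cos (Real.pi / 5)

/-- The ring `ℤ[λ]`, as a subring of `ℝ`. -/
abbrev ZLam : Subalgebra ℤ ℝ := Algebra.adjoin ℤ {lam}

/-- `λ` as an element of `ℤ[λ]`. -/
def lamZ : ZLam := ⟨lam, Algebra.self_mem_adjoin_singleton ℤ lam⟩

/-- The matrix `T = (1, λ; 0, 1)`. -/
def T : SL(2, ZLam) := ⟨!![1, lamZ; 0, 1], by simp [Matrix.det_fin_two]⟩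

/-- The matrix `S = (0, 1; -1, 0)`. -/
def S : SL(2, ZLam) := ⟨!![0, 1; -1, 0], by simp [Matrix.det_fin_two]⟩

/-- The homogeneous Hecke group `H₅ = ⟨S, T⟩`. -/
def H5 : Subgroup SL(2, ZLam) := Subgroup.closure {S, T}

/-- The principal congruence subgroup `H(a) = {A ∈ H₅ : A ≡ I (mod a)}`, as the kernel of
entrywise reduction modulo the ideal `(a)`; see `mem_H_iff`. -/
def H (a : ZLam) : Subgroup H5 :=
  ((Matrix.SpecialLinearGroup.map (n := Fin 2)
    (Ideal.Quotient.mk (Ideal.span {a}))).comp H5.subtype).ker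

instance H_normal (a : ZLam) : (H a).Normal := MonoidHom.normal_ker _

theorem mem_H_iff (a : ZLam) (A : H5) :
    A ∈ H a ↔ ∀ i j, a ∣ (A : SL(2, ZLam)) i j - (1 : Matrix (Fin 2) (Fin 2) ZLam) i j := by
  have key : ∀ x y : ZLam, Ideal.Quotient.mk (Ideal.span {a}) x =
      Ideal.Quotient.mk (Ideal.span {a}) y ↔ a ∣ x - y := fun x y => by
    rw [Ideal.Quotient.eq, Ideal.mem_span_singleton]
  have h1 : ∀ i j, ((1 : SL(2, ZLam ⧸ Ideal.span {a})) i j) =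
      Ideal.Quotient.mk (Ideal.span {a}) ((1 : Matrix (Fin 2) (Fin 2) ZLam) i j) := by
    intro i j
    by_cases h : i = j <;> simp [Matrix.one_apply, h]
  rw [H, MonoidHom.mem_ker, Matrix.SpecialLinearGroup.ext_iff]
  refine forall_congr' fun i => forall_congr' fun j => ?_
  rw [h1, ← key]
  rfl

theorem H_le_of_dvd {a b : ZLam} (h : a ∣ b) : H b ≤ H a := fun A hA => by
  rw [mem_H_iff] at hA ⊢
  exact fun i j => h.trans (hA i j)

theorem neg_one_mem_H5 : (-1 : SL(2, ZLam)) ∈ H5 := by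
  have h : S * S = -1 := by
    apply Subtype.ext
    change S.1 * S.1 = -1
    rw [Matrix.one_fin_two]
    simp [S]
  rw [← h]
  have hS : S ∈ H5 := Subgroup.subset_closure (by simp)
  exact H5.mul_mem hS hS

/-- The subgroup `Z = ⟨± I⟩` of `H₅`. -/
def Z : Subgroup H5 := Subgroup.zpowers ⟨-1, neg_one_mem_H5⟩

theorem Z_le_center : Z ≤ Subgroup.center H5 := by
  rw [Z, Subgroup.zpowers_le, Subgroup.mem_center_iff]
  intro g
  apply Subtype.ext
  simp

instance Z_normal : Z.Normal := by
  refine ⟨fun n hn g => ?_⟩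
  have h := Subgroup.mem_center_iff.mp (Z_le_center hn) g
  rwa [h, mul_inv_cancel_right]

/-- The inhomogeneous Hecke group `G₅ = H₅ / Z`. -/
abbrev G5 : Type := H5 ⧸ Z

/-- The principal congruence subgroup `G(a) = H(a) Z / Z` of `G₅`, the image of `H(a)`. -/
def G (a : ZLam) : Subgroup G5 := (H a).map (QuotientGroup.mk' Z)

instance G_normal (a : ZLam) : (G a).Normal :=
  (H_normal a).map _ (QuotientGroup.mk'_surjective Z)

theorem G_le_of_dvd {a b : ZLam} (h : a ∣ b) : G b ≤ G a := Subgroup.map_mono (H_le_of_dvd h)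

/-- The quotient group `G(a) / G(b)`. It is used only for `a ∣ b`, where `G(b) ≤ G(a)` by
`G_le_of_dvd`. -/
abbrev GQuot (a b : ZLam) : Type := G a ⧸ (G b).subgroupOf (G a)

/-- A group is elementary abelian of order `p ^ k` (with `p` a prime) if it is abelian, every
element is killed by `p`, and it has exactly `p ^ k` elements. -/
def IsElementaryAbelianOfOrder (p k : ℕ) (Q : Type) [Group Q] : Prop :=
  p.Prime ∧ (∀ x y : Q, x * y = y * x) ∧ (∀ x : Q, x ^ p = 1) ∧ Nat.card Q = p ^ k

end HeckeFive

end

/-!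
Since `2` is inert in `ℤ[λ]`, the map `A ↦ (A - 1) / 2 mod 2` embeds `H(2) / H(4)` into the trace
zero matrices over `F₄`, a space of order `2 ^ 6`. Its image is smaller. The linear form
`Y ↦ re tr(U Y)`, where `U = T S` has order five, is invariant under conjugation by `H₅`, so the
elements of `H(2)` killed by it form a normal subgroup of `H₅`. It contains `S ^ 2` and
`S U S⁻¹ U = S T ^ 2 S`, so modulo it `H₅` becomes a dihedral quotient of order at most ten, while
`S` and `U` already generate a group of that order modulo `2`: all of `H(2)` is killed. Conversely,
if `2 ∤ a`, some `T ^ (2 k)` with `k` odd lies in `H(2a)`, and the conjugates of its residue by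
powers of `U` span the kernel of the form, of order `2 ^ 5`. Passing from `H₅` to `G₅` halves the
order exactly when `-1 ∈ H(2a)`, that is, when `a` is a unit.
-/

open scoped MatrixGroups QuadraticAlgebra

namespace HeckeFive

/-! ### Reduction modulo `2` -/

theorem lam_eq_goldenRatio : lam = Real.goldenRatio := by
  rw [lam, Real.cos_pi_div_five, Real.goldenRatio]
  ring

theorem lamZ_mul_lamZ : lamZ * lamZ = lamZ + 1 := by
  refine Subtype.ext ?_
  change lam * lam = lam + 1
  rw [lam_eq_goldenRatio, ← sq, Real.goldenRatio_sq]

/-- The golden integers `ℤ[ω]` with `ω ^ 2 = ω + 1`, an abstract model of `ℤ[λ]` in which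
elements are given by their coordinates. -/
abbrev GoldenInt : Type := QuadraticAlgebra ℤ 1 1

/-- The field with four elements, the residue field of `ℤ[λ]` at the inert prime `2`. -/
abbrev F4 : Type := QuadraticAlgebra (ZMod 2) 1 1

/-- The homomorphism `ℤ[ω] → ℤ[λ]` with `ω ↦ λ`. -/
noncomputable def ofGoldenInt : GoldenInt →ₐ[ℤ] ZLam :=
  QuadraticAlgebra.lift ⟨lamZ, by rw [lamZ_mul_lamZ, one_smul, one_smul, add_comm]⟩

theorem ofGoldenInt_apply (z : GoldenInt) : ofGoldenInt z = (z.re : ZLam) + z.im * lamZ := by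
  simp [ofGoldenInt]

theorem ofGoldenInt_injective : Function.Injective ofGoldenInt := by
  rw [injective_iff_map_eq_zero]
  intro z hz
  have hz : (z.re : ℝ) + z.im * lam = 0 := by
    simpa [ofGoldenInt_apply, lamZ] using congrArg Subtype.val hz
  have him : z.im = 0 := by
    by_contra hne
    rw [lam_eq_goldenRatio] at hz
    exact ((Real.goldenRatio_irrational.intCast_mul hne).intCast_add z.re).ne_zero hz
  exact QuadraticAlgebra.ext (by simpa [him] using hz) him

theorem ofGoldenInt_surjective : Function.Surjective ofGoldenInt := by
  rintro ⟨x, hx⟩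
  have hle : ZLam ≤ (ZLam.val.comp ofGoldenInt).range := by
    rw [Algebra.adjoin_le_iff, Set.singleton_subset_iff]
    exact ⟨ω, by simp [ofGoldenInt_apply, lamZ]⟩
  obtain ⟨z, hz⟩ := hle hx
  exact ⟨z, Subtype.ext hz⟩

/-- The identification of `ℤ[λ]` with the golden integers. -/
noncomputable def goldenEquiv : ZLam ≃ₐ[ℤ] GoldenInt :=
  (AlgEquiv.ofBijective ofGoldenInt
    (show Function.Bijective ofGoldenInt from
      ⟨ofGoldenInt_injective, ofGoldenInt_surjective⟩)).symm

/-- The reduction `ℤ[ω] → F₄` of coordinates modulo `2`. -/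
noncomputable def goldenMod : GoldenInt →ₐ[ℤ] F4 :=
  QuadraticAlgebra.lift ⟨ω, by decide⟩

theorem goldenMod_apply (z : GoldenInt) : goldenMod z = ⟨z.re, z.im⟩ := by
  ext <;> simp [goldenMod]

theorem goldenMod_eq_zero_iff (z : GoldenInt) : goldenMod z = 0 ↔ 2 ∣ z := by
  constructor
  · intro h
    obtain ⟨hre, him⟩ := QuadraticAlgebra.ext_iff.mp ((goldenMod_apply z).symm.trans h)
    obtain ⟨m, hm⟩ := (ZMod.intCast_zmod_eq_zero_iff_dvd _ 2).mp hre
    obtain ⟨n, hn⟩ := (ZMod.intCast_zmod_eq_zero_iff_dvd _ 2).mp him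
    exact ⟨⟨m, n⟩, by ext <;> simp [hm, hn]⟩
  · rintro ⟨w, rfl⟩
    rw [map_mul, map_ofNat]
    exact zero_mul _

/-- The reduction `ℤ[λ] → ℤ[λ] / 2 = F₄`. -/
noncomputable def red : ZLam →+* F4 :=
  (goldenMod.comp goldenEquiv.toAlgHom).toRingHom

theorem red_eq_zero_iff (x : ZLam) : red x = 0 ↔ 2 ∣ x := by
  rw [← map_dvd_iff goldenEquiv, map_ofNat, ← goldenMod_eq_zero_iff]
  rfl

theorem red_two : red 2 = 0 := (red_eq_zero_iff 2).mpr dvd_rfl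

theorem red_lamZ : red lamZ = ω := by
  have h : goldenEquiv lamZ = ω := by
    rw [goldenEquiv, AlgEquiv.symm_apply_eq]
    simp [ofGoldenInt_apply]
  change goldenMod (goldenEquiv lamZ) = ω
  rw [h, goldenMod_apply]
  decide

/-- `x ^ 2 + x + 1` has no root in `ZMod 2`, which makes `F4` a field. -/
instance : Fact (∀ r : ZMod 2, r ^ 2 ≠ 1 + 1 * r) := ⟨by decide⟩

theorem prime_two : Prime (2 : ZLam) := by
  refine ⟨two_ne_zero, fun h => ?_, fun x y h => ?_⟩
  · simpa [red_two] using h.map red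
  · rwa [← red_eq_zero_iff, map_mul, mul_eq_zero, red_eq_zero_iff, red_eq_zero_iff] at h

theorem exists_odd_natCast_dvd {a : ZLam} (ha : ¬ 2 ∣ a) : ∃ k : ℕ, Odd k ∧ a ∣ k := by
  set z := goldenEquiv a
  have hodd : Odd z.norm := by
    have hne : red a ≠ 0 := (red_eq_zero_iff a).not.mpr ha
    have hcast : (z.norm : ZMod 2) = (red a).norm := by
      change _ = (goldenMod z).norm
      simp [goldenMod_apply, QuadraticAlgebra.norm_def]
    rwa [← Int.not_even_iff_odd, ← ZMod.intCast_eq_zero_iff_even, hcast,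
      QuadraticAlgebra.norm_eq_zero_iff_eq_zero]
  have hdvd : a ∣ (z.norm : ZLam) := by
    rw [← map_dvd_iff goldenEquiv, map_intCast]
    exact ⟨star z, z.algebraMap_norm_eq_mul_star⟩
  refine ⟨z.norm.natAbs, Int.natAbs_odd.mpr hodd, ?_⟩
  rcases z.norm.natAbs_eq with h | h <;> rw [h] at hdvd <;> simpa using hdvd

/-! ### The residue of an element of `H(2)` -/

/-- The two by two matrices over `F₄`. -/
abbrev Mat : Type := Matrix (Fin 2) (Fin 2) F4

theorem mem_H_iff_exists (a : ZLam) (A : H5) :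
    A ∈ H a ↔ ∃ X : Matrix (Fin 2) (Fin 2) ZLam, A.1.1 = 1 + a • X := by
  rw [mem_H_iff]
  constructor
  · intro h
    choose X hX using h
    exact ⟨Matrix.of X, Matrix.ext fun i j => (sub_eq_iff_eq_add'.mp (hX i j))⟩
  · rintro ⟨X, hX⟩ i j
    exact ⟨X i j, by simp [hX]⟩

/-- The matrix `(A - 1) / 2` for `A ∈ H(2)`. -/
noncomputable def halfPart (A : H 2) : Matrix (Fin 2) (Fin 2) ZLam :=
  ((mem_H_iff_exists 2 A.1).mp A.2).choose

theorem coe_eq_one_add_two_smul (A : H 2) : A.1.1.1 = 1 + (2 : ZLam) • halfPart A :=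
  ((mem_H_iff_exists 2 A.1).mp A.2).choose_spec

theorem halfPart_eq {A : H 2} {X : Matrix (Fin 2) (Fin 2) ZLam}
    (h : A.1.1.1 = 1 + (2 : ZLam) • X) : halfPart A = X := by
  rw [coe_eq_one_add_two_smul, add_right_inj] at h
  exact smul_right_injective _ two_ne_zero h

theorem halfPart_mul (A B : H 2) : halfPart (A * B) =
    halfPart A + halfPart B + (2 : ZLam) • (halfPart A * halfPart B) := by
  apply halfPart_eq
  change A.1.1.1 * B.1.1.1 = _
  rw [coe_eq_one_add_two_smul, coe_eq_one_add_two_smul B]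
  simp only [mul_add, add_mul, smul_add, smul_mul_assoc, mul_smul_comm, one_mul, mul_one]
  abel

theorem red_mapMatrix_two_smul (X : Matrix (Fin 2) (Fin 2) ZLam) :
    red.mapMatrix ((2 : ZLam) • X) = 0 :=
  Matrix.ext fun i j => by simp [red_two]

/-- The homomorphism `A ↦ (A - 1) / 2 mod 2` on `H(2)`. -/
noncomputable def residue : H 2 →* Multiplicative Mat :=
  .mk' (fun A => .ofAdd (red.mapMatrix (halfPart A))) fun A B => by
    rw [halfPart_mul, map_add, red_mapMatrix_two_smul, add_zero, map_add, ofAdd_add]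

theorem toAdd_residue (A : H 2) : (residue A).toAdd = red.mapMatrix (halfPart A) := rfl

theorem residue_eq {A : H 2} {X : Matrix (Fin 2) (Fin 2) ZLam}
    (h : A.1.1.1 = 1 + (2 : ZLam) • X) : residue A = .ofAdd (red.mapMatrix X) := by
  rw [← halfPart_eq h]
  rfl

theorem ker_residue : residue.ker = (H 4).subgroupOf (H 2) := by
  ext A
  have h4 : (4 : ZLam) = 2 * 2 := by norm_num
  rw [MonoidHom.mem_ker, Subgroup.mem_subgroupOf, mem_H_iff, ← toAdd_eq_zero, toAdd_residue,
    ← Matrix.ext_iff]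
  refine forall_congr' fun i => forall_congr' fun j => ?_
  rw [coe_eq_one_add_two_smul A, h4]
  simp [red_eq_zero_iff, mul_dvd_mul_iff_left]

theorem trace_residue (A : H 2) : (residue A).toAdd.trace = 0 := by
  have hdet : (1 + (2 : ZLam) • halfPart A).det = 1 := coe_eq_one_add_two_smul A ▸ A.1.1.2
  have htrace : 2 ∣ (halfPart A).trace := by
    refine ⟨-(halfPart A).det, mul_left_cancel₀ two_ne_zero ?_⟩
    simp only [Matrix.det_fin_two, Matrix.add_apply, Matrix.smul_apply, smul_eq_mul,
      Matrix.one_apply_eq, Matrix.one_apply_ne (zero_ne_one' (Fin 2)),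
      Matrix.one_apply_ne (one_ne_zero' (Fin 2))] at hdet
    rw [Matrix.trace_fin_two, Matrix.det_fin_two]
    linear_combination hdet
  rw [toAdd_residue, ← (red_eq_zero_iff _).mpr htrace]
  exact (AddMonoidHom.map_trace red.toAddMonoidHom _).symm

/-- The reduction of `H₅` modulo `2`. -/
noncomputable def reduce : H5 →* SL(2, F4) :=
  (Matrix.SpecialLinearGroup.map red).comp H5.subtype

theorem coe_reduce (g : H5) : (reduce g).1 = red.mapMatrix g.1.1 := rfl

theorem ker_reduce : reduce.ker = H 2 := by
  ext A
  rw [MonoidHom.mem_ker, mem_H_iff, Matrix.SpecialLinearGroup.ext_iff]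
  refine forall_congr' fun i => forall_congr' fun j => ?_
  rw [← red_eq_zero_iff, map_sub, sub_eq_zero]
  by_cases h : i = j <;> simp [coe_reduce, Matrix.one_apply, h]

theorem residue_conjNormal (g : H5) (A : H 2) : (residue (MulAut.conjNormal g A)).toAdd =
    (reduce g).1 * (residue A).toAdd * (reduce g⁻¹).1 := by
  have h : (MulAut.conjNormal g A).1.1.1 =
      1 + (2 : ZLam) • (g.1.1 * halfPart A * (g⁻¹).1.1) := by
    have hg : g.1.1 * (g⁻¹).1.1 = 1 := congrArg (fun x : H5 => x.1.1) (mul_inv_cancel g)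
    rw [MulAut.conjNormal_apply]
    change g.1.1 * A.1.1.1 * (g⁻¹).1.1 = _
    rw [coe_eq_one_add_two_smul, mul_add, add_mul, mul_one, hg, mul_smul_comm, smul_mul_assoc]
  rw [residue_eq h, toAdd_ofAdd, map_mul, map_mul, coe_reduce, coe_reduce, toAdd_residue]

/-! ### The upper bound: a parity preserved by conjugation -/

theorem exists_zpow_or_zpow_mul_of_dihedral {Q : Type*} [Group Q] {s u : Q}
    (hgen : Subgroup.closure {s, u} = ⊤) (hs : s * s = 1) (hsu : s * u * s⁻¹ * u = 1) (g : Q) :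
    ∃ k : ℤ, g = u ^ k ∨ g = u ^ k * s := by
  have hinv : SemiconjBy s u u⁻¹ := mul_inv_eq_iff_eq_mul.mp (eq_inv_of_mul_eq_one_left hsu)
  have hzpow (k : ℤ) : s * u ^ k = u ^ (-k) * s := by
    rw [zpow_neg, ← inv_zpow]
    exact hinv.zpow_right k
  have hs' : s⁻¹ = s := inv_eq_of_mul_eq_one_left hs
  have hmul_s {y : Q} (hy : ∃ k : ℤ, y = u ^ k ∨ y = u ^ k * s) :
      ∃ k : ℤ, s * y = u ^ k ∨ s * y = u ^ k * s := by
    obtain ⟨k, rfl | rfl⟩ := hy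
    · exact ⟨-k, .inr (hzpow k)⟩
    · exact ⟨-k, .inl (by rw [← mul_assoc, hzpow, mul_assoc, hs, mul_one])⟩
  have hmul_u (m : ℤ) {y : Q} (hy : ∃ k : ℤ, y = u ^ k ∨ y = u ^ k * s) :
      ∃ k : ℤ, u ^ m * y = u ^ k ∨ u ^ m * y = u ^ k * s := by
    obtain ⟨k, rfl | rfl⟩ := hy
    · exact ⟨m + k, .inl (zpow_add u m k).symm⟩
    · exact ⟨m + k, .inr (by rw [zpow_add, mul_assoc])⟩
  have hg : g ∈ Subgroup.closure {s, u} := hgen ▸ Subgroup.mem_top g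
  induction hg using Subgroup.closure_induction_left with
  | one => exact ⟨0, .inl (zpow_zero u).symm⟩
  | mul_left x hx y _ hy =>
    obtain rfl | rfl := hx
    · exact hmul_s hy
    · simpa only [zpow_one] using hmul_u 1 hy
  | inv_mul_cancel x hx y _ hy =>
    obtain rfl | rfl := hx
    · exact hs'.symm ▸ hmul_s hy
    · simpa only [zpow_neg_one] using hmul_u (-1) hy

/-- The generator `S` of `H₅`. -/
noncomputable def genS : H5 := ⟨S, Subgroup.subset_closure (.inl rfl)⟩

/-- The generator `T` of `H₅`. -/
noncomputable def genT : H5 := ⟨T, Subgroup.subset_closure (.inr rfl)⟩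

/-- The element `U = T S` of order five, which together with `S` generates `H₅`. -/
noncomputable def genU : H5 := genT * genS

theorem closure_genS_genU : Subgroup.closure {genS, genU} = ⊤ := by
  have hpre : Subgroup.closure ((↑) ⁻¹' {S, T} : Set H5) = ⊤ :=
    Subgroup.closure_closure_coe_preimage
  rw [← top_le_iff, ← hpre, Subgroup.closure_le]
  have hS : genS ∈ Subgroup.closure {genS, genU} := Subgroup.subset_closure (.inl rfl)
  have hU : genU ∈ Subgroup.closure {genS, genU} := Subgroup.subset_closure (.inr rfl)
  rintro x (hx | hx)
  · rwa [show x = genS from Subtype.ext hx]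
  · rw [show x = genT from Subtype.ext hx, ← mul_inv_cancel_right genT genS]
    exact mul_mem hU (inv_mem hS)

theorem coe_genS : genS.1.1 = !![0, 1; -1, 0] := rfl

theorem coe_genU : genU.1.1 = !![-lamZ, 1; -1, 0] := by
  change T.1 * S.1 = _
  simp [T, S]

theorem genU_pow_five : genU ^ 5 = 1 := by
  have hU2 : genU.1.1 * genU.1.1 = !![lamZ, -lamZ; lamZ, -1] := by
    rw [coe_genU]
    simp [lamZ_mul_lamZ]
  have hU3 : genU.1.1 * !![lamZ, -lamZ; lamZ, -1] = !![-1, lamZ; -lamZ, lamZ] := by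
    rw [coe_genU]
    simp [lamZ_mul_lamZ]
  have hU5 : !![lamZ, -lamZ; lamZ, -1] * !![-1, lamZ; -lamZ, lamZ] = 1 := by
    rw [Matrix.one_fin_two]
    simp [lamZ_mul_lamZ]
  refine Subtype.ext (Subtype.ext ?_)
  change genU.1.1 ^ 5 = 1
  rw [show 5 = 2 + (1 + 2) from rfl, pow_add, pow_add, pow_one, sq, hU2, hU3, hU5]

theorem neg_eq_self_F4 (x : F4) : -x = x := by
  ext <;> exact CharTwo.neg_eq _

theorem coe_reduce_genS : (reduce genS).1 = !![0, 1; 1, 0] := by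
  rw [coe_reduce, coe_genS, RingHom.mapMatrix_apply]
  ext1 i j
  fin_cases i <;> fin_cases j <;> simp [neg_eq_self_F4]

theorem coe_reduce_genU : (reduce genU).1 = !![ω, 1; 1, 0] := by
  rw [coe_reduce, coe_genU, RingHom.mapMatrix_apply]
  ext1 i j
  fin_cases i <;> fin_cases j <;> simp [red_lamZ, neg_eq_self_F4]

theorem coe_reduce_genU_inv : (reduce genU⁻¹).1 = !![0, 1; 1, ω] := by
  rw [map_inv, Matrix.SpecialLinearGroup.coe_inv, coe_reduce_genU, Matrix.adjugate_fin_two_of,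
    neg_eq_self_F4]

theorem orderOf_reduce_genU : orderOf (reduce genU) = 5 := by
  have : Fact (Nat.Prime 5) := ⟨Nat.prime_five⟩
  refine orderOf_eq_prime (by rw [← map_pow, genU_pow_five, map_one]) fun h => ?_
  have h := congrArg (fun M => M.1 1 1) h
  rw [coe_reduce_genU] at h
  simp at h

theorem coe_reduce_mul_inv (g : H5) : (reduce g).1 * (reduce g⁻¹).1 = 1 := by
  rw [map_inv]
  exact congrArg Subtype.val (mul_inv_cancel (reduce g))

theorem coe_reduce_inv_mul (g : H5) : (reduce g⁻¹).1 * (reduce g).1 = 1 := by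
  simpa only [inv_inv] using coe_reduce_mul_inv g⁻¹

/-- The form `Y ↦ re tr(U Y)` on matrices over `F₄`. On trace zero matrices it is invariant under
conjugation by `H₅`, see `parity_conj`. -/
noncomputable def parity : Mat →+ ZMod 2 where
  toFun Y := ((reduce genU).1 * Y).trace.re
  map_zero' := by simp
  map_add' Y Z := by simp only [mul_add, Matrix.trace_add, QuadraticAlgebra.re_add]

theorem parity_apply (Y : Mat) : parity Y = ((reduce genU).1 * Y).trace.re := rfl

theorem parity_eq (Y : Mat) : parity Y = (Y 0 0).im + (Y 0 1).re + (Y 1 0).re := by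
  rw [parity_apply, coe_reduce_genU, Matrix.trace_fin_two, Matrix.mul_apply, Matrix.mul_apply]
  simp [Fin.sum_univ_two, add_right_comm]

-- Modulo `2`, conjugation by `S` adds the scalar `ω` to `U`; pairing with a trace zero matrix does
-- not see it.
theorem exists_reduce_genU_mul_eq (g : H5) : ∃ c : F4,
    (reduce genU).1 * (reduce g).1 = (reduce g).1 * ((reduce genU).1 + c • 1) := by
  have hg : g ∈ Subgroup.closure {genS, genU} := closure_genS_genU ▸ Subgroup.mem_top g
  induction hg using Subgroup.closure_induction with
  | mem x hx =>
    obtain rfl | rfl := hx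
    · refine ⟨ω, ?_⟩
      rw [coe_reduce_genS, coe_reduce_genU]
      decide
    · exact ⟨0, by rw [zero_smul, add_zero]⟩
  | one => exact ⟨0, by simp⟩
  | mul g h _ _ hg hh =>
    obtain ⟨c, hc⟩ := hg
    obtain ⟨d, hd⟩ := hh
    refine ⟨d + c, ?_⟩
    have hmul : (reduce (g * h)).1 = (reduce g).1 * (reduce h).1 := by
      rw [map_mul]
      rfl
    rw [hmul, ← mul_assoc, hc, mul_assoc, mul_assoc, add_mul, hd]
    simp only [add_smul, mul_add, smul_mul_assoc, one_mul, mul_smul_comm, mul_one]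
    abel_nf
  | inv g _ hg =>
    obtain ⟨c, hc⟩ := hg
    refine ⟨-c, ?_⟩
    calc (reduce genU).1 * (reduce g⁻¹).1
      _ = (reduce g⁻¹).1 * ((reduce g).1 * ((reduce genU).1 + c • 1) - c • (reduce g).1) *
          (reduce g⁻¹).1 := by
        rw [mul_add, mul_smul_comm, mul_one, add_sub_cancel_right, ← mul_assoc,
          coe_reduce_inv_mul, one_mul]
      _ = (reduce g⁻¹).1 * ((reduce genU).1 + -c • 1) := by
        rw [← hc, mul_sub, sub_mul, mul_assoc, mul_assoc _ _ (reduce g⁻¹).1,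
          coe_reduce_mul_inv, mul_smul_comm, coe_reduce_inv_mul, smul_mul_assoc,
          one_mul, mul_add, mul_smul_comm, mul_one, mul_one, neg_smul,
          sub_eq_add_neg]

theorem parity_conj (g : H5) {Y : Mat} (hY : Y.trace = 0) :
    parity ((reduce g).1 * Y * (reduce g⁻¹).1) = parity Y := by
  obtain ⟨c, hc⟩ := exists_reduce_genU_mul_eq g
  rw [parity_apply, ← mul_assoc, ← mul_assoc, hc, Matrix.trace_mul_comm, ← mul_assoc, ← mul_assoc,
    coe_reduce_inv_mul, one_mul, add_mul, Matrix.trace_add, smul_mul_assoc, one_mul,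
    Matrix.trace_smul, hY, smul_zero, add_zero, parity_apply]

/-- The elements of `H(2)` whose residue has even parity, as a subgroup of `H₅`. It equals `H(2)`,
see `parity_residue`. -/
noncomputable def evenH2 : Subgroup H5 :=
  (parity.toMultiplicative.comp residue).ker.map (H 2).subtype

theorem coe_mem_evenH2 (A : H 2) : A.1 ∈ evenH2 ↔ parity (residue A).toAdd = 0 :=
  Subgroup.mem_map_iff_mem (H 2).subtype_injective

instance : evenH2.Normal where
  conj_mem := by
    rintro _ ⟨A, hA, rfl⟩ g
    have h := (coe_mem_evenH2 A).mp ⟨A, hA, rfl⟩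
    rw [Subgroup.subtype_apply, ← MulAut.conjNormal_apply, coe_mem_evenH2, residue_conjNormal,
      parity_conj g (trace_residue A), h]

theorem mem_evenH2_of_eq {g : H5} {X : Matrix (Fin 2) (Fin 2) ZLam}
    (hg : g.1.1 = 1 + (2 : ZLam) • X) (hX : parity (red.mapMatrix X) = 0) : g ∈ evenH2 := by
  have hgH : g ∈ H 2 := (mem_H_iff_exists 2 g).mpr ⟨X, hg⟩
  have hres : residue ⟨g, hgH⟩ = .ofAdd (red.mapMatrix X) := residue_eq hg
  exact (coe_mem_evenH2 ⟨g, hgH⟩).mpr (hres ▸ hX)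

theorem genS_mul_genS_mem_evenH2 : genS * genS ∈ evenH2 := by
  refine mem_evenH2_of_eq (X := -1) ?_ ?_
  · have hsq : genS.1.1 * genS.1.1 = -1 := by simp [coe_genS, Matrix.one_fin_two]
    change genS.1.1 * genS.1.1 = _
    rw [hsq]
    module
  · rw [map_neg, map_one, map_neg, parity_eq]
    simp

theorem genS_conj_genU_mul_genU_mem_evenH2 : genS * genU * genS⁻¹ * genU ∈ evenH2 := by
  refine mem_evenH2_of_eq (X := !![-1, 0; lamZ, -1]) ?_ ?_
  · have hprod : genS.1.1 * genU.1.1 * (genS⁻¹).1.1 * genU.1.1 =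
        !![-1, 0; lamZ + lamZ, -1] := by
      simp [coe_genS, coe_genU]
    have hneg : (1 + -2 : ZLam) = -1 := by norm_num
    change genS.1.1 * genU.1.1 * (genS⁻¹).1.1 * genU.1.1 = _
    rw [hprod]
    simp [Matrix.one_fin_two, hneg, two_mul]
  · rw [parity_eq]
    simp [red_lamZ]

theorem exists_mk_eq_zpow_or_zpow_mul (g : H5) : ∃ k : ℤ,
    (g : H5 ⧸ evenH2) = ↑(genU ^ k) ∨ (g : H5 ⧸ evenH2) = ↑(genU ^ k * genS) := by
  let q := QuotientGroup.mk' evenH2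
  have hgen : Subgroup.closure {q genS, q genU} = ⊤ := by
    rw [← Set.image_pair, ← MonoidHom.map_closure, closure_genS_genU,
      Subgroup.map_top_of_surjective _ (QuotientGroup.mk'_surjective _)]
  have hs : q genS * q genS = 1 :=
    (QuotientGroup.eq_one_iff _).mpr genS_mul_genS_mem_evenH2
  have hsu : q genS * q genU * (q genS)⁻¹ * q genU = 1 :=
    (QuotientGroup.eq_one_iff _).mpr genS_conj_genU_mul_genU_mem_evenH2
  exact exists_zpow_or_zpow_mul_of_dihedral hgen hs hsu (q g)

theorem evenH2_le : evenH2 ≤ H 2 := Subgroup.map_subtype_le _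

theorem not_commute_reduce_genS_genU : ¬ Commute (reduce genS) (reduce genU) := fun h => by
  have hmat : (reduce genS).1 * (reduce genU).1 = (reduce genU).1 * (reduce genS).1 :=
    congrArg Subtype.val h
  rw [coe_reduce_genS, coe_reduce_genU] at hmat
  revert hmat
  decide

theorem parity_residue (A : H 2) : parity (residue A).toAdd = 0 := by
  have hred {g : H5} (h : (A.1 : H5 ⧸ evenH2) = g) : reduce g = 1 := by
    have hmem : A.1⁻¹ * g ∈ H 2 := evenH2_le (QuotientGroup.eq.mp h)
    rw [← MonoidHom.mem_ker, ker_reduce]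
    exact (mul_mem_cancel_left (inv_mem A.2)).mp hmem
  rw [← coe_mem_evenH2, ← QuotientGroup.eq_one_iff]
  obtain ⟨k, h | h⟩ := exists_mk_eq_zpow_or_zpow_mul A.1
  · have hpow : reduce genU ^ k = 1 := by rw [← map_zpow, hred h]
    obtain ⟨m, rfl⟩ : (5 : ℤ) ∣ k := by
      exact_mod_cast orderOf_reduce_genU ▸ orderOf_dvd_iff_zpow_eq_one.mpr hpow
    have hU : genU ^ (5 : ℤ) = 1 := mod_cast genU_pow_five
    rw [h, zpow_mul, hU, one_zpow, QuotientGroup.mk_one]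
  · have hprod : reduce genU ^ k * reduce genS = 1 := by rw [← map_zpow, ← map_mul, hred h]
    refine absurd ?_ not_commute_reduce_genS_genU
    rw [eq_inv_of_mul_eq_one_right hprod]
    exact ((Commute.refl _).zpow_left k).inv_left

/-! ### The lower bound: conjugates of a power of `T` -/

/-- The group of trace zero matrices of even parity, the set of residues of `H(2)`. -/
noncomputable def evenMat : AddSubgroup Mat :=
  (Matrix.traceAddMonoidHom (Fin 2) F4).ker ⊓ parity.ker

theorem mem_evenMat {Y : Mat} : Y ∈ evenMat ↔ Y.trace = 0 ∧ parity Y = 0 := Iff.rfl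

theorem mem_evenMat_iff {Y : Mat} :
    Y ∈ evenMat ↔ Y 1 1 = Y 0 0 ∧ (Y 1 0).re = (Y 0 0).im + (Y 0 1).re := by
  rw [mem_evenMat, parity_eq, Matrix.trace_fin_two, add_eq_zero_iff_neg_eq, neg_eq_self_F4,
    eq_comm (b := Y 1 1), add_eq_zero_iff_neg_eq, CharTwo.neg_eq, eq_comm (b := (Y 1 0).re)]

/-- The free coordinates of a matrix in `evenMat`. -/
noncomputable def evenMatEquiv : evenMat ≃ F4 × F4 × ZMod 2 where
  toFun Y := (Y.1 0 0, Y.1 0 1, (Y.1 1 0).im)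
  invFun p := ⟨!![p.1, p.2.1; ⟨p.1.im + p.2.1.re, p.2.2⟩, p.1], mem_evenMat_iff.mpr ⟨rfl, rfl⟩⟩
  left_inv := by
    rintro ⟨Y, hY⟩
    obtain ⟨h11, h10⟩ := mem_evenMat_iff.mp hY
    refine Subtype.ext ?_
    ext1 i j
    fin_cases i <;> fin_cases j <;> simp [h11, ← h10]
  right_inv _ := rfl

theorem card_evenMat : Nat.card evenMat = 2 ^ 5 := by
  have hF4 : Nat.card F4 = 2 * 2 := by
    rw [Nat.card_congr (QuadraticAlgebra.equivProd 1 1), Nat.card_prod, Nat.card_zmod]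
  rw [Nat.card_congr evenMatEquiv, Nat.card_prod, Nat.card_prod, Nat.card_zmod, hF4]
  norm_num

theorem eq_sum_of_mem_evenMat {Y : Mat} (hY : Y ∈ evenMat) : Y =
    ((Y 0 0).re + (Y 0 1).re + (Y 0 1).im) • !![0, ω; 0, 0] +
    ((Y 0 0).re + (Y 0 0).im + (Y 0 1).re) • !![1 + ω, 1; ω, 1 + ω] +
    ((Y 0 0).re + (Y 0 0).im) • !![1, 1; 1, 1] +
    ((Y 0 0).re + (Y 0 1).re) • !![1 + ω, ω; 1, 1 + ω] +
    ((Y 0 0).re + (Y 0 0).im + (Y 0 1).re + (Y 1 0).im) • !![0, 0; ω, 0] := by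
  obtain ⟨h11, h10⟩ := mem_evenMat_iff.mp hY
  ext1 i j
  ext <;> fin_cases i <;> fin_cases j <;> simp [h11, h10] <;> grind

theorem evenMat_le_of_conj_stable {W : AddSubgroup Mat} (hω : !![0, ω; 0, 0] ∈ W)
    (hconj : ∀ Y ∈ W, (reduce genU).1 * Y * (reduce genU⁻¹).1 ∈ W) : evenMat ≤ W := by
  have hnext {Y Y' : Mat} (hY : Y ∈ W) (h : !![ω, 1; 1, 0] * Y * !![0, 1; 1, ω] = Y') :
      Y' ∈ W := by
    rw [← h, ← coe_reduce_genU, ← coe_reduce_genU_inv]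
    exact hconj Y hY
  have hU1 : !![1 + ω, 1; ω, 1 + ω] ∈ W := hnext hω (by decide)
  have hU2 : !![1, 1; 1, 1] ∈ W := hnext hU1 (by decide)
  have hU3 : !![1 + ω, ω; 1, 1 + ω] ∈ W := hnext hU2 (by decide)
  have hU4 : !![0, 0; ω, 0] ∈ W := hnext hU3 (by decide)
  have hsmul (c : ZMod 2) {M : Mat} (hM : M ∈ W) : c • M ∈ W := ZMod.smul_mem hM c
  intro Y hY
  rw [eq_sum_of_mem_evenMat hY]
  exact add_mem (add_mem (add_mem (add_mem (hsmul _ hω) (hsmul _ hU1)) (hsmul _ hU2)) (hsmul _ hU3))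
    (hsmul _ hU4)

/-- The additive group of residues of the elements of `H(2a)`. -/
noncomputable def residues (a : ZLam) : AddSubgroup Mat :=
  (((H (2 * a)).subgroupOf (H 2)).map residue).toAddSubgroup'

theorem mem_residues {a : ZLam} {Y : Mat} :
    Y ∈ residues a ↔ ∃ A : H 2, A.1 ∈ H (2 * a) ∧ (residue A).toAdd = Y := Iff.rfl

theorem residues_le_evenMat (a : ZLam) : residues a ≤ evenMat := by
  rintro _ ⟨A, -, rfl⟩
  exact ⟨trace_residue A, parity_residue A⟩

theorem conj_mem_residues {a : ZLam} {Y : Mat} (g : H5) (hY : Y ∈ residues a) :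
    (reduce g).1 * Y * (reduce g⁻¹).1 ∈ residues a := by
  obtain ⟨A, hA, rfl⟩ := mem_residues.mp hY
  rw [← residue_conjNormal]
  exact mem_residues.mpr ⟨_, (H_normal (2 * a)).conj_mem _ hA g, rfl⟩

theorem coe_genT_pow (n : ℕ) : (genT ^ n).1.1 = !![1, n * lamZ; 0, 1] := by
  induction n with
  | zero => simp [Matrix.one_fin_two]
  | succ n ih =>
    rw [pow_succ]
    change (genT ^ n).1.1 * T.1 = _
    rw [ih]
    simp [T, add_mul, add_comm]

theorem omega_mem_residues {a : ZLam} (ha : ¬ 2 ∣ a) : !![0, ω; 0, 0] ∈ residues a := by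
  obtain ⟨k, hk, c, hc⟩ := exists_odd_natCast_dvd ha
  have hT : (genT ^ (2 * k)).1.1 = 1 + (2 * a) • !![0, c * lamZ; 0, 0] := by
    rw [coe_genT_pow, Nat.cast_mul, hc, Matrix.one_fin_two]
    simp [mul_assoc]
  have hT' : (genT ^ (2 * k)).1.1 = 1 + (2 : ZLam) • !![0, k * lamZ; 0, 0] := by
    rw [coe_genT_pow, Nat.cast_mul, Matrix.one_fin_two]
    simp [mul_assoc]
  refine mem_residues.mpr ⟨⟨genT ^ (2 * k), (mem_H_iff_exists 2 _).mpr ⟨_, hT'⟩⟩,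
    (mem_H_iff_exists _ _).mpr ⟨_, hT⟩, ?_⟩
  rw [residue_eq hT', toAdd_ofAdd, RingHom.mapMatrix_apply]
  have hk1 : (k : F4) = 1 := by
    ext
    · simpa using ZMod.natCast_eq_one_iff_odd.mpr hk
    · simp
  ext1 i j
  fin_cases i <;> fin_cases j <;> simp [red_lamZ, hk1]

theorem residues_eq_evenMat {a : ZLam} (ha : ¬ 2 ∣ a) : residues a = evenMat :=
  (residues_le_evenMat a).antisymm <| evenMat_le_of_conj_stable (omega_mem_residues ha)
    fun _ => conj_mem_residues genU

theorem four_mul_dvd {a x : ZLam} (ha : ¬ 2 ∣ a) (h4 : 4 ∣ x) (h2a : 2 * a ∣ x) : 4 * a ∣ x := by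
  obtain ⟨y, rfl⟩ := h2a
  rw [show (4 : ZLam) = 2 * 2 by norm_num, mul_assoc 2 a y,
    mul_dvd_mul_iff_left two_ne_zero] at h4
  obtain ⟨z, rfl⟩ := (prime_two.dvd_or_dvd h4).resolve_left ha
  exact ⟨z, by ring⟩

theorem H_four_inf_H_two_mul {a : ZLam} (ha : ¬ 2 ∣ a) : H 4 ⊓ H (2 * a) = H (4 * a) := by
  refine le_antisymm (fun A hA => ?_) (le_inf (H_le_of_dvd ⟨a, rfl⟩) (H_le_of_dvd ⟨2, by ring⟩))
  rw [Subgroup.mem_inf, mem_H_iff, mem_H_iff] at hA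
  exact (mem_H_iff _ A).mpr fun i j => four_mul_dvd ha (hA.1 i j) (hA.2 i j)

theorem relIndex_H_four_mul_H_two_mul {a : ZLam} (ha : ¬ 2 ∣ a) :
    (H (4 * a)).relIndex (H (2 * a)) = 2 ^ 5 := by
  rw [← H_four_inf_H_two_mul ha, Subgroup.inf_relIndex_right,
    ← Subgroup.relIndex_subgroupOf (H_le_of_dvd ⟨a, rfl⟩), ← ker_residue, Subgroup.relIndex_ker,
    ← card_evenMat, ← residues_eq_evenMat ha]
  rfl

/-! ### Passing to `G₅` -/

theorem relIndex_sup_sup_mul_relIndex {Γ : Type*} [Group Γ] {A B : Subgroup Γ} [A.Normal]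
    [B.Normal] (h : B ≤ A) (N : Subgroup Γ) :
    (B ⊔ N).relIndex (A ⊔ N) * B.relIndex N = B.relIndex A * A.relIndex N := by
  rw [← Subgroup.relIndex_sup_left N B, ← Subgroup.relIndex_sup_left N A, mul_comm,
    Subgroup.relIndex_mul_relIndex _ _ _ le_sup_left (sup_le_sup_right h N),
    Subgroup.relIndex_mul_relIndex _ _ _ h le_sup_left]

theorem card_GQuot_mul_relIndex {a b : ZLam} (hab : a ∣ b) :
    Nat.card (GQuot a b) * (H b).relIndex Z = (H b).relIndex (H a) * (H a).relIndex Z := by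
  have hcard : Nat.card (GQuot a b) = (H b ⊔ Z).relIndex (H a ⊔ Z) := by
    change (G b).relIndex (G a) = _
    rw [G, G, Subgroup.relIndex_map_map, QuotientGroup.ker_mk']
  rw [hcard, relIndex_sup_sup_mul_relIndex (H_le_of_dvd hab)]

theorem neg_one_mem_H_iff (a : ZLam) : (⟨-1, neg_one_mem_H5⟩ : H5) ∈ H a ↔ a ∣ 2 := by
  have h2 : (-1 - 1 : ZLam) = -2 := by norm_num
  rw [mem_H_iff]
  simp [Fin.forall_fin_two, h2]

theorem card_Z : Nat.card Z = 2 := by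
  have : Fact (Nat.Prime 2) := ⟨Nat.prime_two⟩
  rw [Z, Nat.card_zpowers]
  refine orderOf_eq_prime (Subtype.ext (by simp)) fun h => ?_
  have h0 : (0 : ZLam) ∣ 2 := (neg_one_mem_H_iff 0).mp (h ▸ one_mem _)
  exact two_ne_zero (zero_dvd_iff.mp h0)

theorem relIndex_Z_eq_one_iff {a : ZLam} : (H a).relIndex Z = 1 ↔ a ∣ 2 := by
  rw [Subgroup.relIndex_eq_one, Z, Subgroup.zpowers_le, neg_one_mem_H_iff]

theorem relIndex_Z_of_not_dvd {a : ZLam} (ha : ¬ a ∣ 2) : (H a).relIndex Z = 2 := by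
  have hdvd : (H a).relIndex Z ∣ Nat.card Z := Subgroup.relIndex_dvd_card (H a) Z
  rw [card_Z] at hdvd
  exact ((Nat.dvd_prime Nat.prime_two).mp hdvd).resolve_left (relIndex_Z_eq_one_iff.not.mpr ha)

theorem card_GQuot_mul_two {a : ZLam} (ha : ¬ 2 ∣ a) :
    Nat.card (GQuot (2 * a) (4 * a)) * 2 = 2 ^ 5 * (H (2 * a)).relIndex Z := by
  have h4 : ¬ 4 * a ∣ 2 := fun ⟨c, hc⟩ => prime_two.not_isUnit <|
    isUnit_of_dvd_one ⟨a * c, mul_left_cancel₀ two_ne_zero (by linear_combination hc)⟩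
  rw [← relIndex_H_four_mul_H_two_mul ha, ← card_GQuot_mul_relIndex ⟨2, by ring⟩,
    relIndex_Z_of_not_dvd h4]

theorem card_GQuot_two_four : Nat.card (GQuot 2 4) = 2 ^ 4 := by
  have hcard := card_GQuot_mul_two (fun h : 2 ∣ 1 => prime_two.not_isUnit (isUnit_of_dvd_one h))
  rw [mul_one, mul_one, relIndex_Z_eq_one_iff.mpr dvd_rfl] at hcard
  exact Nat.eq_of_mul_eq_mul_right two_pos hcard

theorem card_GQuot_two_mul_four_mul {a : ZLam} (ha : ¬ 2 ∣ a) (hunit : ¬ IsUnit a) :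
    Nat.card (GQuot (2 * a) (4 * a)) = 2 ^ 5 := by
  have h2a : ¬ 2 * a ∣ 2 := fun ⟨c, hc⟩ => hunit <|
    isUnit_of_dvd_one ⟨c, mul_left_cancel₀ two_ne_zero (by linear_combination hc)⟩
  have hcard := card_GQuot_mul_two ha
  rw [relIndex_Z_of_not_dvd h2a] at hcard
  exact Nat.eq_of_mul_eq_mul_right two_pos hcard

theorem sq_mem_H_four_mul {a : ZLam} {A : H5} (hA : A ∈ H (2 * a)) : A ^ 2 ∈ H (4 * a) := by
  obtain ⟨X, hX⟩ := (mem_H_iff_exists _ A).mp hA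
  refine (mem_H_iff_exists _ _).mpr ⟨X + a • (X * X), ?_⟩
  change A.1.1 ^ 2 = _
  rw [hX, sq, add_mul, mul_add, mul_add, one_mul, mul_one, one_mul, smul_mul_smul_comm]
  module

theorem sq_GQuot_eq_one {a : ZLam} (x : GQuot (2 * a) (4 * a)) : x ^ 2 = 1 := by
  obtain ⟨⟨_, A, hA, rfl⟩, rfl⟩ := QuotientGroup.mk_surjective x
  rw [← QuotientGroup.mk_pow, QuotientGroup.eq_one_iff, Subgroup.mem_subgroupOf]
  exact ⟨A ^ 2, sq_mem_H_four_mul hA, map_pow _ A 2⟩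

theorem isElementaryAbelianOfOrder_two_of_sq_eq_one {k : ℕ} {Q : Type} [Group Q]
    (hsq : ∀ x : Q, x ^ 2 = 1) (hcard : Nat.card Q = 2 ^ k) : IsElementaryAbelianOfOrder 2 k Q :=
  ⟨Nat.prime_two, Commute.of_orderOf_dvd_two fun x => orderOf_dvd_of_pow_eq_one (hsq x), hsq, hcard⟩

end HeckeFive

theorem lemma2p3 :
    HeckeFive.IsElementaryAbelianOfOrder 2 4 (HeckeFive.GQuot 2 4) ∧
    ∀ a : HeckeFive.ZLam, IsRelPrime 2 a → ¬ IsUnit a →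
      HeckeFive.IsElementaryAbelianOfOrder 2 5 (HeckeFive.GQuot (2 * a) (4 * a)) := by
  open HeckeFive in
  constructor
  · have hsq (x : GQuot 2 4) : x ^ 2 = 1 := by
      have h := sq_GQuot_eq_one (a := 1)
      rw [mul_one, mul_one] at h
      exact h x
    exact isElementaryAbelianOfOrder_two_of_sq_eq_one hsq card_GQuot_two_four
  · intro a hrel hunit
    have ha : ¬ 2 ∣ a := prime_two.irreducible.isRelPrime_iff_not_dvd.mp hrel
    exact isElementaryAbelianOfOrder_two_of_sq_eq_one sq_GQuot_eq_one
      (card_GQuot_two_mul_four_mul ha hunit)
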